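/- Let $d,k\ge 1$ be integers and let $C$ be a $d$-variate copula, i.e. the distribution function of a probability measure on $\mathbb R^d$ all of whose one-dimensional margins are uniform on $[0,1]$. Let $\delta>0$ and suppose that $C$ is in the $\delta$-neighborhood of a generalized Pareto copula, i.e. there is a norm $\|\cdot\|_D$ on $\mathbb R^d$ with $$C(\mathbf u)=1-\|\mathbf u-\mathbf 1\|_D+O\bigl(\|\mathbf u-\mathbf 1\|_D^{1+\delta}\bigr)\qquad\text{as } \mathbf u\to\mathbf 1,\ \mathbf u\in[0,1]^d ,$$ where $\mathbf 1=(1,\dots,1)$. Let $\mathbf U^{(1)},\mathbf U^{(2)},\dots$ be independent random vectors with distribution function $C$. For $0<c<1$, $n\in\mathbb N$ and $1\le j\le k$ let $$n_j(c)=\#\Bigl\{1\le i\le n:\ U^{(i)}_m>1-\tfrac cj\ \text{ for at least one } m\in\{1,\dots,d\}\Bigr\}$$ and $$T_n(c)=\frac{\sum_{j=1}^k\Bigl(j\,n_j(c)-\frac1k\sum_{\ell=1}^k\ell\,n_\ell(c)\Bigr)^2}{\frac1k\sum_{\ell=1}^k\ell\,n_\ell(c)},$$ with $T_n(c)=0$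 if the denominator vanishes. Let $(c_n)$ be a sequence in $(0,1)$ such that $c_n\to0$, $nc_n\to\infty$ and $nc_n^{1+2\delta}\to0$ as $n\to\infty$. Then, as $n\to\infty$, $T_n(c_n)$ converges in distribution to $$\sum_{i=1}^{k-1}\lambda_i\xi_i^2,\qquad \lambda_i=\frac1{4\sin^2\bigl(\frac ik\frac\pi2\bigr)},$$ where $\xi_1,\dots,\xi_{k-1}$ are independent standard normal random variables (for $k=1$ the limit is $0$). -/

import Mathlib

open MeasureTheory ProbabilityTheory Filter Topology Asymptotics

noncomputable section

/-- A `d`-variate copula: the distribution function of a probability measure on `ℝ^d` all of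
whose one-dimensional margins are uniform on `[0, 1]`. -/
def IsCopula {d : ℕ} (C : (Fin d → ℝ) → ℝ) : Prop :=
  ∃ μ : Measure (Fin d → ℝ), IsProbabilityMeasure μ ∧
    (∀ i, μ.map (fun x => x i) = (volume : Measure ℝ).restrict (Set.Icc 0 1)) ∧
    ∀ u, C u = μ.real (Set.Iic u)

/-- `N` is a norm on `ℝ^d` (a seminorm that vanishes only at `0`) such that
`C u = 1 - N (u - 1) + o (N (u - 1))` as `u → 1` uniformly in `[0, 1]^d`, that is, `N` is the
`D`-norm of the copula `C`. -/
def IsDNormOf {d : ℕ} (C : (Fin d → ℝ) → ℝ) (N : Seminorm ℝ (Fin d → ℝ)) : Prop :=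
  (∀ x, N x = 0 → x = 0) ∧
    (fun u => C u - (1 - N (u - 1))) =o[𝓝[Set.Icc 0 1] 1] (fun u => N (u - 1))

/-- `C` is in the `δ`-neighborhood of a generalized Pareto copula: for its `D`-norm `N`,
`C u = 1 - N (u - 1) + O (N (u - 1) ^ (1 + δ))` as `u → 1` in `[0, 1]^d`. -/
def InDeltaNeighborhood {d : ℕ} (δ : ℝ) (C : (Fin d → ℝ) → ℝ) : Prop :=
  ∃ N : Seminorm ℝ (Fin d → ℝ), IsDNormOf C N ∧
    (fun u => C u - (1 - N (u - 1))) =O[𝓝[Set.Icc 0 1] 1] (fun u => N (u - 1) ^ (1 + δ))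

/-- The number `S_u(s)` of components of `u - 1` that exceed the threshold `s`. -/
def sojourn {d : ℕ} (u : Fin d → ℝ) (s : ℝ) : ℝ :=
  ∑ i, (Set.Ioi s).indicator (fun _ => (1 : ℝ)) (u i - 1)

/-- The number `n_j(c)` of the first `n` sample vectors whose sojourn above `1 - c / j` is
positive. -/
def exceedanceCount {d : ℕ} (x : ℕ → Fin d → ℝ) (n j : ℕ) (c : ℝ) : ℝ :=
  ∑ i ∈ Finset.range n, (Set.Ioi (0 : ℝ)).indicator (fun _ => (1 : ℝ)) (sojourn (x i) (-(c / j)))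

/-- The average `(1 / k) * ∑_{ℓ = 1}^k ℓ n_ℓ(c)`. -/
def meanWeightedCount {d : ℕ} (x : ℕ → Fin d → ℝ) (k n : ℕ) (c : ℝ) : ℝ :=
  1 / (k : ℝ) * ∑ l ∈ Finset.Icc 1 k, (l : ℝ) * exceedanceCount x n l c

/-- The test statistic `T_n(c)`; it is `0` on the event where its denominator vanishes. -/
def testStatistic {d : ℕ} (x : ℕ → Fin d → ℝ) (k n : ℕ) (c : ℝ) : ℝ :=
  (∑ j ∈ Finset.Icc 1 k, ((j : ℝ) * exceedanceCount x n j c - meanWeightedCount x k n c) ^ 2) /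
    meanWeightedCount x k n c

/-- The weight `λ_i = 1 / (4 sin² ((i / k) (π / 2)))`. -/
def limitWeight (k i : ℕ) : ℝ :=
  1 / (4 * Real.sin ((i : ℝ) / k * (Real.pi / 2)) ^ 2)

end

/-! Let `m` be the `D`-norm of the vector of ones. On the diagonal, the probability that some
component exceeds `1 - c / j` is `m c / j + O(c ^ (1 + δ))`, so all the counts `j n_j` have the same
leading mean `s ^ 2 = n c m`. On the fluctuation scale `s` the error in this mean is of order `√(n c
^ (1 + 2δ))`, which vanishes. The events are nested in `j`, so the rescaled vector of the `(j n_j -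
s ^ 2) / s` has limiting covariance `min j l`.

The numerator of the statistic is the squared norm of the centred vector of the `j n_j`. The
discrete cosine vectors are an orthonormal basis of the centred vectors and diagonalize the form
`min j l` there, with eigenvalues `limitWeight k i`. Parseval (`sum_sub_mean_sq`) and a central
limit theorem for triangular arrays (`tendstoInDistribution_cos_transform`) then handle the
numerator. The denominator divided by `s ^ 2` tends to `1` in probability
(`tendstoInMeasure_mean_count`), and Slutsky's theorem combines the two. -/

/-! ### Limit theorems for triangular arrays. -/

theorem norm_cexp_mul_I_sub_le {x : ℝ} (hx : |x| ≤ 1) :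
    ‖Complex.exp (x * Complex.I) - (1 + x * Complex.I - x ^ 2 / 2)‖ ≤ |x| ^ 3 := by
  have h := Complex.exp_bound (x := x * Complex.I) (by simpa using hx) (n := 3) (by norm_num)
  have e : ∑ m ∈ Finset.range 3, (x * Complex.I) ^ m / (m.factorial : ℂ) =
      1 + x * Complex.I - x ^ 2 / 2 := by
    simp [Finset.sum_range_succ, mul_pow, Nat.factorial]
    ring
  rw [e] at h
  refine h.trans ?_
  have : ‖(x : ℂ) * Complex.I‖ = |x| := by simp
  rw [this]
  refine mul_le_of_le_one_right (by positivity) ?_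
  norm_num [Nat.factorial]

/-- Bounded measurable functions are square integrable for a finite measure. -/
theorem memLp_two_of_abs_le {α : Type*} [MeasurableSpace α] {μ : Measure α} [IsFiniteMeasure μ]
    {g : α → ℝ} (hg : Measurable g) {K : ℝ} (hK : ∀ x, |g x| ≤ K) : MemLp g 2 μ :=
  MemLp.of_bound hg.aestronglyMeasurable K (ae_of_all _ hK)

/-- The characteristic function of a row sum of a triangular array of centred, uniformly small
variables, identically distributed within each row. -/
theorem tendsto_integral_cexp_pow {α : Type*} [MeasurableSpace α] {μ : Measure α}
    [IsProbabilityMeasure μ] {g : ℕ → α → ℝ} (hg : ∀ n, Measurable (g n)) {K : ℕ → ℝ}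
    (hK : ∀ n x, |g n x| ≤ K n) (hK0 : Tendsto K atTop (𝓝 0))
    (h1 : Tendsto (fun n : ℕ => (n : ℝ) * ∫ x, g n x ∂μ) atTop (𝓝 0)) {v : ℝ}
    (h2 : Tendsto (fun n : ℕ => (n : ℝ) * ∫ x, g n x ^ 2 ∂μ) atTop (𝓝 v)) :
    Tendsto (fun n : ℕ => (∫ x, Complex.exp (g n x * Complex.I) ∂μ) ^ n) atTop
      (𝓝 (Complex.exp (-v / 2))) := by
  have hi1 : ∀ n, Integrable (g n) μ := fun n =>
    (memLp_two_of_abs_le (hg n) (hK n)).integrable (by norm_num)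
  have hi2 : ∀ n, Integrable (fun x => g n x ^ 2) μ := fun n =>
    (memLp_two_of_abs_le (hg n) (hK n)).integrable_sq
  have hie : ∀ n, Integrable (fun x => Complex.exp (g n x * Complex.I)) μ := fun n =>
    Integrable.of_bound (C := 1)
      ((Complex.measurable_exp.comp
        ((Complex.measurable_ofReal.comp (hg n)).mul_const _)).aestronglyMeasurable)
      (ae_of_all _ fun x => (Complex.norm_exp_ofReal_mul_I _).le)
  have hip : ∀ n, Integrable
      (fun x => (1 : ℂ) + g n x * Complex.I - (g n x : ℂ) ^ 2 / 2) μ := fun n => by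
    refine ((integrable_const _).add ((hi1 n).ofReal.mul_const _)).sub ?_
    simpa using (hi2 n).ofReal.div_const (2 : ℂ)
  have hint : ∀ n, ∫ x, ((1 : ℂ) + g n x * Complex.I - (g n x : ℂ) ^ 2 / 2) ∂μ =
      1 + (∫ x, g n x ∂μ : ℝ) * Complex.I - (∫ x, g n x ^ 2 ∂μ : ℝ) / 2 := fun n => by
    have hi3 : Integrable (fun x => (g n x : ℂ) ^ 2 / 2) μ := by
      simpa using (hi2 n).ofReal.div_const (2 : ℂ)
    have hi4 : Integrable (fun x => (g n x : ℂ) * Complex.I) μ := (hi1 n).ofReal.mul_const _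
    have hi5 : Integrable (fun x => (1 : ℂ) + g n x * Complex.I) μ := (integrable_const _).add hi4
    rw [integral_sub hi5 hi3, integral_add (integrable_const _) hi4, integral_mul_const,
      integral_div, integral_complex_ofReal]
    have : ∫ x, (g n x : ℂ) ^ 2 ∂μ = ((∫ x, g n x ^ 2 ∂μ : ℝ) : ℂ) := by
      rw [← integral_complex_ofReal]; simp
    rw [this]
    simp
  -- The uniform bound replaces Lindeberg's condition: the cubic remainder is at most `K n` times
  -- the second moment, and `n` times the latter converges.
  have hR : Tendsto (fun n : ℕ => (n : ℂ) * ∫ x, (Complex.exp (g n x * Complex.I) -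
      (1 + g n x * Complex.I - (g n x : ℂ) ^ 2 / 2)) ∂μ) atTop (𝓝 0) := by
    have hb : Tendsto (fun n : ℕ => K n * ((n : ℝ) * ∫ x, g n x ^ 2 ∂μ)) atTop (𝓝 0) := by
      simpa using hK0.mul h2
    refine squeeze_zero_norm' ?_ hb
    filter_upwards [hK0.eventually (eventually_le_nhds (zero_lt_one' ℝ))] with n hn
    rw [norm_mul, Complex.norm_natCast, mul_left_comm, ← integral_const_mul]
    refine mul_le_mul_of_nonneg_left ?_ (by positivity)
    refine norm_integral_le_of_norm_le ((hi2 n).const_mul _) (ae_of_all _ fun x => ?_)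
    refine (norm_cexp_mul_I_sub_le ((hK n x).trans hn)).trans ?_
    rw [pow_succ', sq_abs]
    exact mul_le_mul_of_nonneg_right (hK n x) (sq_nonneg _)
  have hmain : Tendsto (fun n : ℕ => (n : ℂ) *
      ((∫ x, Complex.exp (g n x * Complex.I) ∂μ) - 1)) atTop (𝓝 (-v / 2)) := by
    have h1' := ((Complex.continuous_ofReal.tendsto _).comp h1).mul_const Complex.I
    have h2' := ((Complex.continuous_ofReal.tendsto _).comp h2).div_const 2
    have := (hR.add h1').sub h2'
    simp only [Complex.ofReal_zero, zero_mul, add_zero, zero_sub] at this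
    rw [neg_div]
    refine this.congr fun n => ?_
    rw [integral_sub (hie n) (hip n), hint n]
    simp only [Function.comp, Complex.ofReal_mul, Complex.ofReal_natCast]
    ring
  simpa using Complex.tendsto_one_add_pow_exp_of_tendsto hmain

/-- A multivariate central limit theorem for triangular arrays `g n i (X r)`, `r < n`, built from
an independent and identically distributed sequence `X`. -/
theorem tendstoInDistribution_sum_rows {α : Type*} [MeasurableSpace α] {μ : Measure α}
    [IsProbabilityMeasure μ]
    {Ω : Type*} [MeasurableSpace Ω] {P : Measure Ω} [IsProbabilityMeasure P]
    {X : ℕ → Ω → α} (hX : ∀ r, HasLaw (X r) μ P) (hXm : ∀ r, Measurable (X r))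
    (hindep : iIndepFun X P)
    {Ω' : Type*} [MeasurableSpace Ω'] {P' : Measure Ω'} [IsProbabilityMeasure P']
    {ι : Type*} [Fintype ι] [DecidableEq ι] {ξ : ι → Ω' → ℝ}
    (hξ : ∀ i, HasLaw (ξ i) (gaussianReal 0 1) P') (hξindep : iIndepFun ξ P')
    {g : ℕ → ι → α → ℝ} (hg : ∀ n i, Measurable (g n i)) {K : ℕ → ℝ}
    (hK : ∀ n i x, |g n i x| ≤ K n) (hK0 : Tendsto K atTop (𝓝 0))
    (h1 : ∀ i, Tendsto (fun n : ℕ => (n : ℝ) * ∫ x, g n i x ∂μ) atTop (𝓝 0))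
    (h2 : ∀ i j, Tendsto (fun n : ℕ => (n : ℝ) * ∫ x, g n i x * g n j x ∂μ) atTop
      (𝓝 (if i = j then 1 else 0))) :
    TendstoInDistribution (fun (n : ℕ) (ω : Ω) (i : ι) => ∑ r ∈ Finset.range n, g n i (X r ω))
      atTop (fun ω' i => ξ i ω') (fun _ => P) P' := by
  have hi1 : ∀ n i, Integrable (g n i) μ := fun n i =>
    (memLp_two_of_abs_le (hg n i) (hK n i)).integrable (by norm_num)
  have hi2 : ∀ n i j, Integrable (fun x => g n i x * g n j x) μ := fun n i j =>
    (memLp_two_of_abs_le (hg n i) (hK n i)).integrable_mul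
      (memLp_two_of_abs_le (hg n j) (hK n j))
  have hξm : ∀ i, AEMeasurable (ξ i) P' := fun i => (hξ i).aemeasurable
  have hmeas : ∀ n : ℕ, Measurable fun ω =>
      WithLp.toLp 2 (fun i => ∑ r ∈ Finset.range n, g n i (X r ω)) := fun n => by
    refine (WithLp.measurable_toLp 2 _).comp (measurable_pi_lambda _ fun i => ?_)
    exact Finset.measurable_fun_sum _ fun r _ => (hg n i).comp (hXm r)
  -- Lévy's continuity theorem needs an inner product, so the convergence is shown in the Euclidean
  -- space and transported back at the end.
  have key : TendstoInDistribution
      (fun (n : ℕ) (ω : Ω) => WithLp.toLp 2 (fun i => ∑ r ∈ Finset.range n, g n i (X r ω)))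
      atTop (fun ω' => WithLp.toLp 2 (fun i => ξ i ω')) (fun _ => P) P' := by
    refine ⟨fun n => (hmeas n).aemeasurable,
      (WithLp.measurable_toLp 2 _).comp_aemeasurable (aemeasurable_pi_lambda _ hξm), ?_⟩
    refine ProbabilityMeasure.tendsto_of_tendsto_charFun fun t => ?_
    have hlim : charFun (P'.map fun ω' => WithLp.toLp 2 (fun i => ξ i ω')) t =
        Complex.exp (-(∑ i, t i ^ 2 : ℝ) / 2) := by
      rw [(iIndepFun_iff_charFun_pi hξm).1 hξindep t]
      simp_rw [(hξ _).map_eq, charFun_gaussianReal]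
      rw [← Complex.exp_sum]
      congr 1
      simp [Finset.sum_div, neg_div]
    have hrow : ∀ n : ℕ, charFun (P.map fun ω =>
        WithLp.toLp 2 (fun i => ∑ r ∈ Finset.range n, g n i (X r ω))) t =
        (∫ x, Complex.exp ((∑ i, t i * g n i x : ℝ) * Complex.I) ∂μ) ^ n := fun n => by
      have hG : Measurable fun x => WithLp.toLp 2 (fun i => g n i x) :=
        (WithLp.measurable_toLp 2 _).comp (measurable_pi_lambda _ fun i => hg n i)
      have e : (fun ω => WithLp.toLp 2 (fun i => ∑ r ∈ Finset.range n, g n i (X r ω))) =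
          fun ω => ∑ r ∈ Finset.range n, WithLp.toLp 2 (fun i => g n i (X r ω)) := by
        ext ω i
        simp
      have hind : iIndepFun (fun r ω => WithLp.toLp 2 (fun i => g n i (X r ω))) P :=
        hindep.comp (fun _ x => WithLp.toLp 2 (fun i => g n i x)) fun _ => hG
      rw [e, iIndepFun.charFun_map_fun_finsetSum_eq_prod
        (X := fun r ω => WithLp.toLp 2 (fun i => g n i (X r ω))) (hX := hind.restrict _)
        fun r _ => (hG.comp (hXm r)).aemeasurable]
      rw [Finset.prod_apply, Finset.prod_eq_pow_card (b := ∫ x, Complex.exp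
        ((∑ i, t i * g n i x : ℝ) * Complex.I) ∂μ), Finset.card_range]
      intro r _
      have : P.map (fun ω => WithLp.toLp 2 (fun i => g n i (X r ω))) =
          μ.map (fun x => WithLp.toLp 2 (fun i => g n i x)) := by
        rw [← (hX r).map_eq, Measure.map_map hG (hXm r)]; rfl
      rw [this, charFun_apply, integral_map hG.aemeasurable (by fun_prop)]
      simp [PiLp.inner_apply]
    -- As in the Cramér–Wold device, each linear combination is a one-dimensional array; its
    -- limiting variance is the squared length of `t`.
    have hconv := tendsto_integral_cexp_pow (μ := μ) (g := fun n x => ∑ i, t i * g n i x)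
      (K := fun n => ∑ i, |t i| * K n) (v := ∑ i, t i ^ 2)
      (fun n => Finset.measurable_fun_sum _ fun i _ => (hg n i).const_mul _)
      (fun n x => (Finset.abs_sum_le_sum_abs _ _).trans <| Finset.sum_le_sum fun i _ => by
        rw [abs_mul]; exact mul_le_mul_of_nonneg_left (hK n i x) (abs_nonneg _))
      (by simpa using tendsto_finsetSum Finset.univ fun i _ => hK0.const_mul |t i|) ?_ ?_
    · simp only [ProbabilityMeasure.coe_mk]
      rw [hlim]
      simp_rw [hrow]
      exact hconv
    · have := tendsto_finsetSum Finset.univ fun i _ => (h1 i).const_mul (t i)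
      simp only [mul_zero, Finset.sum_const_zero] at this
      refine this.congr fun n => ?_
      rw [integral_finsetSum _ fun i _ => (hi1 n i).const_mul _, Finset.mul_sum]
      refine Finset.sum_congr rfl fun i _ => ?_
      rw [integral_const_mul]
      ring
    · have := tendsto_finsetSum Finset.univ fun i _ =>
        tendsto_finsetSum Finset.univ fun j _ => (h2 i j).const_mul (t i * t j)
      have e : ∑ i, ∑ j, t i * t j * (if i = j then (1 : ℝ) else 0) = ∑ i, t i ^ 2 := by
        simp [sq]
      rw [e] at this
      refine this.congr fun n => ?_
      have e2 : ∀ x, (∑ i, t i * g n i x) ^ 2 =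
          ∑ i, ∑ j, t i * t j * (g n i x * g n j x) := fun x => by
        rw [sq, Finset.sum_mul_sum]
        exact Finset.sum_congr rfl fun i _ => Finset.sum_congr rfl fun j _ => by ring
      simp_rw [e2]
      rw [integral_finsetSum _ fun i _ => integrable_finsetSum _ fun j _ =>
        (hi2 n i j).const_mul _, Finset.mul_sum]
      refine Finset.sum_congr rfl fun i _ => ?_
      rw [integral_finsetSum _ fun j _ => (hi2 n i j).const_mul _, Finset.mul_sum]
      refine Finset.sum_congr rfl fun j _ => ?_
      rw [integral_const_mul]
      ring
  exact key.continuous_comp (g := WithLp.ofLp) (PiLp.continuous_ofLp 2 _)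

/-- A weak law of large numbers for triangular arrays `g n (X r)`, `r < n`, built from an
independent and identically distributed sequence `X`. -/
theorem tendstoInMeasure_sum_rows {α : Type*} [MeasurableSpace α] {μ : Measure α}
    [IsProbabilityMeasure μ]
    {Ω : Type*} [MeasurableSpace Ω] {P : Measure Ω} [IsProbabilityMeasure P]
    {X : ℕ → Ω → α} (hX : ∀ r, HasLaw (X r) μ P) (hXm : ∀ r, Measurable (X r))
    (hindep : iIndepFun X P) {g : ℕ → α → ℝ} (hg : ∀ n, Measurable (g n)) {K : ℕ → ℝ}
    (hK : ∀ n x, |g n x| ≤ K n) {a : ℝ}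
    (h1 : Tendsto (fun n : ℕ => (n : ℝ) * ∫ x, g n x ∂μ) atTop (𝓝 a))
    (h2 : Tendsto (fun n : ℕ => (n : ℝ) * ∫ x, g n x ^ 2 ∂μ) atTop (𝓝 0)) :
    TendstoInMeasure P (fun n ω => ∑ r ∈ Finset.range n, g n (X r ω)) atTop (fun _ => a) := by
  have hL : ∀ n r, MemLp (fun ω => g n (X r ω)) 2 P := fun n r =>
    memLp_two_of_abs_le ((hg n).comp (hXm r)) fun ω => hK n _
  have hE : ∀ n r, ∫ ω, g n (X r ω) ∂P = ∫ x, g n x ∂μ := fun n r =>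
    (hX r).integral_comp (hg n).aestronglyMeasurable
  have hE2 : ∀ n r, ∫ ω, g n (X r ω) ^ 2 ∂P = ∫ x, g n x ^ 2 ∂μ := fun n r =>
    (hX r).integral_comp (f := fun x => g n x ^ 2) ((hg n).pow_const 2).aestronglyMeasurable
  have hmean : ∀ n : ℕ, ∫ ω, ∑ r ∈ Finset.range n, g n (X r ω) ∂P = n * ∫ x, g n x ∂μ :=
    fun n => by
      rw [integral_finsetSum _ fun r _ => (hL n r).integrable (by norm_num)]
      simp [hE]
  have hvar : ∀ n : ℕ, Var[fun ω => ∑ r ∈ Finset.range n, g n (X r ω); P] ≤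
      n * ∫ x, g n x ^ 2 ∂μ := fun n => by
    have e : (fun ω => ∑ r ∈ Finset.range n, g n (X r ω)) =
        ∑ r ∈ Finset.range n, fun ω => g n (X r ω) := by ext; simp
    rw [e, IndepFun.variance_sum (fun r _ => hL n r) fun i _ j _ hij =>
      (hindep.indepFun hij).comp (hg n) (hg n)]
    refine (Finset.sum_le_sum fun r _ => variance_le_expectation_sq (hL n r).1).trans ?_
    simp [hE2]
  rw [tendstoInMeasure_iff_dist]
  intro ε hε
  have hb : Tendsto (fun n : ℕ => ENNReal.ofReal ((n * ∫ x, g n x ^ 2 ∂μ) / (ε / 2) ^ 2)) atTop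
      (𝓝 0) := by
    simpa using ENNReal.tendsto_ofReal (h2.div_const ((ε / 2) ^ 2))
  refine tendsto_of_tendsto_of_tendsto_of_le_of_le' tendsto_const_nhds hb
    (Eventually.of_forall fun _ => zero_le) ?_
  -- Half of `ε` covers the distance from the mean to `a`, the other half is left to Chebyshev.
  filter_upwards [h1.eventually (Metric.ball_mem_nhds a (half_pos hε))] with n hn
  have hS : MemLp (fun ω => ∑ r ∈ Finset.range n, g n (X r ω)) 2 P :=
    memLp_finsetSum _ fun r _ => hL n r
  refine (measure_mono fun ω hω => ?_).trans
    ((meas_ge_le_variance_div_sq hS (half_pos hε)).trans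
      (ENNReal.ofReal_le_ofReal (div_le_div_of_nonneg_right (hvar n) (by positivity))))
  simp only [Set.mem_ofPred_eq, Real.dist_eq, hmean] at hω hn ⊢
  have := abs_sub_le (∑ r ∈ Finset.range n, g n (X r ω)) (n * ∫ x, g n x ∂μ) a
  linarith

/-! ### Continuous mapping at a constant, and uniqueness of laws. -/

/-- Convergence in measure to a constant is preserved by functions continuous there. -/
theorem TendstoInMeasure.comp_continuousAt {Ω : Type*} [MeasurableSpace Ω] {P : Measure Ω}
    {Y : ℕ → Ω → ℝ} {a : ℝ} (h : TendstoInMeasure P Y atTop (fun _ => a)) {f : ℝ → ℝ}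
    (hf : ContinuousAt f a) :
    TendstoInMeasure P (fun n ω => f (Y n ω)) atTop (fun _ => f a) := by
  rw [tendstoInMeasure_iff_dist] at h ⊢
  intro ε hε
  obtain ⟨η, hη, hηf⟩ := Metric.continuousAt_iff.1 hf ε hε
  refine tendsto_of_tendsto_of_tendsto_of_le_of_le tendsto_const_nhds (h η hη)
    (fun _ => zero_le) fun n => measure_mono fun ω hω => ?_
  simp only [Set.mem_ofPred_eq] at hω ⊢
  by_contra! hlt
  exact absurd (hηf hlt) (not_lt.2 hω)

/-- Finite measures on `ℝ^d` with the same distribution function are equal. -/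
theorem measure_eq_of_forall_Iic_eq {d : ℕ} {μ ν : Measure (Fin d → ℝ)} [IsProbabilityMeasure μ]
    [IsProbabilityMeasure ν] (h : ∀ u, μ (Set.Iic u) = ν (Set.Iic u)) : μ = ν := by
  have hgen : MeasurableSpace.pi = MeasurableSpace.generateFrom
      (Set.univ.pi '' Set.univ.pi fun _ : Fin d => Set.range (Set.Iic : ℝ → Set ℝ)) := by
    refine (generateFrom_eq_pi (fun _ => ?_) fun _ => ?_).symm
    · rw [← borel_eq_generateFrom_Iic, ← BorelSpace.measurable_eq]
    · refine ⟨fun n : ℕ => Set.Iic (n : ℝ), fun n => ⟨n, rfl⟩, ?_⟩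
      exact Set.eq_univ_of_forall fun x => Set.mem_iUnion.2 (exists_nat_ge x)
  refine ext_of_generate_finite _ hgen (IsPiSystem.pi fun _ => isPiSystem_Iic) ?_ (by simp)
  rintro _ ⟨s, hs, rfl⟩
  choose u hu using fun i => hs i trivial
  have : Set.univ.pi s = Set.Iic u := by
    rw [← Set.pi_univ_Iic]
    exact congrArg _ (funext fun i => (hu i).symm)
  rw [this, h]

/-! ### The discrete cosine transform and the matrix `min j l`. -/

/-- The sum telescopes: `2 sin (θ / 2)` times the `j`-th cosine is `sin (j θ) - sin ((j - 1) θ)`. -/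
theorem two_mul_sin_mul_sum_cos (θ : ℝ) (n : ℕ) :
    2 * Real.sin (θ / 2) * ∑ j ∈ Finset.Icc 1 n, Real.cos ((j - 1 / 2) * θ) =
      Real.sin (n * θ) := by
  induction n with
  | zero => simp
  | succ n ih =>
    rw [Finset.sum_Icc_succ_top (by omega), mul_add, ih]
    push_cast
    have h1 : ((n : ℝ) + 1) * θ = (n + 1 - 1 / 2) * θ + θ / 2 := by ring
    have h2 : (n : ℝ) * θ = (n + 1 - 1 / 2) * θ - θ / 2 := by ring
    rw [h1, h2, Real.sin_add, Real.sin_sub]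
    ring

theorem sum_cos_eq_zero {θ : ℝ} {n : ℕ} (h0 : Real.sin (θ / 2) ≠ 0)
    (hn : Real.sin (n * θ) = 0) :
    ∑ j ∈ Finset.Icc 1 n, Real.cos ((j - 1 / 2) * θ) = 0 := by
  have h := two_mul_sin_mul_sum_cos θ n
  rw [hn] at h
  exact (mul_eq_zero.1 h).resolve_left (mul_ne_zero two_ne_zero h0)

/-- The matrix `min j l` applied to a discrete cosine vector. -/
theorem sin_sq_mul_sum_min_mul_cos {θ : ℝ} {n : ℕ} (hn : Real.sin (n * θ) = 0) {j : ℕ}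
    (hj : j ≤ n) :
    4 * Real.sin (θ / 2) ^ 2 *
        ∑ l ∈ Finset.Icc 1 n, (min j l : ℕ) * Real.cos ((l - 1 / 2) * θ) =
      Real.cos ((j - 1 / 2) * θ) - Real.cos (θ / 2) := by
  induction j with
  | zero =>
    have : ((0 : ℕ) - 1 / 2 : ℝ) * θ = -(θ / 2) := by push_cast; ring
    rw [this, Real.cos_neg]
    simp
  | succ j ih =>
    -- Raising `j` by one raises the minimum by one exactly when `l > j`, so the increment is a tail
    -- of the cosine sum. As the full sum contributes nothing, multiplying the tail by `4 sin² (θ /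
    -- 2)` gives `-2 sin (θ / 2) sin (j θ)`, a difference of consecutive cosines.
    have hstep : ∑ l ∈ Finset.Icc 1 n, ((min (j + 1) l : ℕ) : ℝ) * Real.cos ((l - 1 / 2) * θ) =
        ∑ l ∈ Finset.Icc 1 n, ((min j l : ℕ) : ℝ) * Real.cos ((l - 1 / 2) * θ) +
        (∑ l ∈ Finset.Icc 1 n, Real.cos ((l - 1 / 2) * θ) -
          ∑ l ∈ Finset.Icc 1 j, Real.cos ((l - 1 / 2) * θ)) := by
      have hf : Finset.Icc 1 j = (Finset.Icc 1 n).filter (· ≤ j) := by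
        ext l; simp only [Finset.mem_Icc, Finset.mem_filter]; omega
      rw [hf, Finset.sum_filter, ← Finset.sum_sub_distrib, ← Finset.sum_add_distrib]
      refine Finset.sum_congr rfl fun l _ => ?_
      split_ifs with h
      · rw [min_eq_right h, min_eq_right (by omega)]; ring
      · rw [min_eq_left (by omega), min_eq_left (by omega)]; push_cast; ring
    have ha := two_mul_sin_mul_sum_cos θ n
    have hb := two_mul_sin_mul_sum_cos θ j
    rw [hstep, mul_add, ih (by omega)]
    rw [hn] at ha
    have h1 : ((j + 1 : ℕ) - 1 / 2 : ℝ) * θ = j * θ + θ / 2 := by push_cast; ring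
    have h2 : ((j : ℝ) - 1 / 2) * θ = j * θ - θ / 2 := by ring
    rw [h1, h2, Real.cos_add, Real.cos_sub]
    linear_combination 2 * Real.sin (θ / 2) * ha - 2 * Real.sin (θ / 2) * hb

/-- The vectors of the discrete cosine transform of length `k`. -/
noncomputable def cosVec (k i j : ℕ) : ℝ :=
  Real.sqrt (2 / k) * Real.cos ((j - 1 / 2) * (i * Real.pi / k))

/-- With `θ = r π / k`, `sin (k θ) = 0` always, while `sin (θ / 2) = 0` would make `r` a multiple of
`2 k`. The range up to `2 k` accommodates the sums and differences of two frequencies below `k`. -/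
theorem sum_cos_int_eq_zero {k : ℕ} {r : ℤ} (hr : r ≠ 0) (h1 : |r| < 2 * k) :
    ∑ j ∈ Finset.Icc 1 k, Real.cos ((j - 1 / 2) * (r * Real.pi / k)) = 0 := by
  have hk : (k : ℝ) ≠ 0 := by
    rintro h
    have : k = 0 := by exact_mod_cast h
    subst this
    have := abs_nonneg r
    simp at h1
    omega
  refine sum_cos_eq_zero (fun h => ?_) ?_
  · obtain ⟨m, hm⟩ := Real.sin_eq_zero_iff.1 h
    have e : (m : ℝ) * (2 * k) = r := by
      field_simp at hm
      linarith
    have e' : m * (2 * k) = r := by exact_mod_cast e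
    rw [← e', abs_mul] at h1
    have h2 : |(2 * k : ℤ)| = 2 * k := abs_of_nonneg (by positivity)
    rw [h2] at h1
    have hm0 : m ≠ 0 := by rintro rfl; simp at e'; exact hr e'.symm
    have := Int.one_le_abs hm0
    nlinarith
  · rw [mul_div_cancel₀ _ hk]
    exact Real.sin_int_mul_pi r

theorem sum_cosVec_eq_zero {k i : ℕ} (hi : 1 ≤ i) (hik : i < k) :
    ∑ j ∈ Finset.Icc 1 k, cosVec k i j = 0 := by
  have h := sum_cos_int_eq_zero (k := k) (r := i) (by omega) (by rw [abs_of_nonneg] <;> omega)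
  simp only [cosVec, ← Finset.mul_sum]
  rw [Int.cast_natCast] at h
  rw [h, mul_zero]

/-- Product-to-sum leaves the frequencies `i - l` and `i + l`, whose cosine sums vanish unless the
frequency is zero; that happens only for `i = l`, where the sum is `k`. -/
theorem sum_cosVec_mul_cosVec {k i l : ℕ} (hi : 1 ≤ i) (hik : i < k) (hl : 1 ≤ l) (hlk : l < k) :
    ∑ j ∈ Finset.Icc 1 k, cosVec k i j * cosVec k l j = if i = l then 1 else 0 := by
  have hk : (0 : ℝ) < k := by exact_mod_cast (by omega : 0 < k)
  have e : ∀ j : ℕ, cosVec k i j * cosVec k l j = 1 / k *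
      (Real.cos ((j - 1 / 2) * (((i : ℤ) - l : ℤ) * Real.pi / k)) +
        Real.cos ((j - 1 / 2) * (((i : ℤ) + l : ℤ) * Real.pi / k))) := fun j => by
    have hs : Real.sqrt (2 / k) * Real.sqrt (2 / k) = 2 / k := Real.mul_self_sqrt (by positivity)
    have e1 : ((j : ℝ) - 1 / 2) * (((i : ℤ) - l : ℤ) * Real.pi / k) =
        (j - 1 / 2) * (i * Real.pi / k) - (j - 1 / 2) * (l * Real.pi / k) := by
      push_cast; ring
    have e2 : ((j : ℝ) - 1 / 2) * (((i : ℤ) + l : ℤ) * Real.pi / k) =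
        (j - 1 / 2) * (i * Real.pi / k) + (j - 1 / 2) * (l * Real.pi / k) := by
      push_cast; ring
    rw [e1, e2, Real.cos_sub, Real.cos_add, cosVec, cosVec]
    linear_combination Real.cos ((j - 1 / 2) * (i * Real.pi / k)) *
      Real.cos ((j - 1 / 2) * (l * Real.pi / k)) * hs
  simp_rw [e]
  rw [← Finset.mul_sum, Finset.sum_add_distrib,
    sum_cos_int_eq_zero (r := (i : ℤ) + l) (by omega) (by rw [abs_of_nonneg] <;> omega)]
  split_ifs with h
  · subst h
    simp [hk.ne']
  · rw [sum_cos_int_eq_zero (r := (i : ℤ) - l) (by omega) (by rw [abs_lt]; omega)]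
    simp

/-- The discrete cosine vectors diagonalize the matrix `min j l` on centred vectors. -/
theorem sum_sum_min_mul_cosVec {k i l : ℕ} (hi : 1 ≤ i) (hik : i < k) (hl : 1 ≤ l) (hlk : l < k) :
    ∑ j ∈ Finset.Icc 1 k, ∑ m ∈ Finset.Icc 1 k,
      cosVec k i j * cosVec k l m * (min j m : ℕ) = if i = l then limitWeight k i else 0 := by
  have hk : (0 : ℝ) < k := by exact_mod_cast (by omega : 0 < k)
  have hsin : 0 < Real.sin (l * Real.pi / k / 2) := by
    have hl' : (0 : ℝ) < l := by exact_mod_cast hl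
    have hlk' : (l : ℝ) < k := by exact_mod_cast hlk
    refine Real.sin_pos_of_pos_of_lt_pi (by positivity) ?_
    rw [div_div, div_lt_iff₀ (by positivity)]
    nlinarith [Real.pi_pos]
  have hn : Real.sin (k * (l * Real.pi / k)) = 0 := by
    rw [mul_div_cancel₀ _ hk.ne']
    exact Real.sin_nat_mul_pi l
  have hw : limitWeight k l = 1 / (4 * Real.sin (l * Real.pi / k / 2) ^ 2) := by
    rw [limitWeight]; congr 4; ring
  -- A cosine vector is an eigenvector of `min j m` only up to an additive constant vector, which
  -- disappears when paired with the centred vector `cosVec k i`.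
  have e : ∀ j ∈ Finset.Icc 1 k,
      ∑ m ∈ Finset.Icc 1 k, cosVec k i j * cosVec k l m * (min j m : ℕ) =
      limitWeight k l * (cosVec k i j * cosVec k l j) -
        limitWeight k l * Real.sqrt (2 / k) * Real.cos (l * Real.pi / k / 2) * cosVec k i j := by
    intro j hj
    have h := sin_sq_mul_sum_min_mul_cos hn (Finset.mem_Icc.1 hj).2
    have e1 : ∑ m ∈ Finset.Icc 1 k, cosVec k i j * cosVec k l m * (min j m : ℕ) =
        cosVec k i j * Real.sqrt (2 / k) * ∑ m ∈ Finset.Icc 1 k,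
          (min j m : ℕ) * Real.cos ((m - 1 / 2) * (l * Real.pi / k)) := by
      rw [Finset.mul_sum]
      refine Finset.sum_congr rfl fun m _ => ?_
      rw [cosVec, cosVec]
      ring
    rw [e1, hw, cosVec, cosVec]
    generalize Real.cos ((j - 1 / 2) * (i * Real.pi / k)) = x at *
    generalize Real.cos ((j - 1 / 2) * (l * Real.pi / k)) = y at *
    generalize Real.cos (l * Real.pi / k / 2) = z at *
    generalize Real.sin (l * Real.pi / k / 2) = w at *
    generalize √(2 / (k : ℝ)) = q at *
    generalize ∑ m ∈ Finset.Icc 1 k,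
      ((min j m : ℕ) : ℝ) * Real.cos ((m - 1 / 2) * (l * Real.pi / k)) = A at *
    field_simp
    linear_combination x * q ^ 2 * h
  rw [Finset.sum_congr rfl e, Finset.sum_sub_distrib, ← Finset.mul_sum, ← Finset.mul_sum,
    sum_cosVec_eq_zero hi hik, sum_cosVec_mul_cosVec hi hik hl hlk]
  split_ifs with h
  · subst h; simp
  · simp

/-- Parseval's identity for the discrete cosine transform of a centred vector. -/
theorem sum_sub_mean_sq {k : ℕ} (hk : 1 ≤ k) (y : ℕ → ℝ) :
    ∑ j ∈ Finset.Icc 1 k, (y j - 1 / (k : ℝ) * ∑ l ∈ Finset.Icc 1 k, y l) ^ 2 =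
      ∑ i : Fin (k - 1), (∑ j ∈ Finset.Icc 1 k, cosVec k (i + 1) j * y j) ^ 2 := by
  obtain ⟨n, rfl⟩ : ∃ n, k = n + 1 := ⟨k - 1, by omega⟩
  have hIcc : ∀ f : ℕ → ℝ, ∑ j ∈ Finset.Icc 1 (n + 1), f j = ∑ j : Fin (n + 1), f (j + 1) :=
    fun f => by
      rw [Fin.sum_univ_eq_sum_range (fun j => f (j + 1)), Finset.range_eq_Ico,
        Finset.sum_Ico_add' f 0 (n + 1) 1]
      rfl
  have hk0 : (0 : ℝ) < ((n + 1 : ℕ) : ℝ) := by positivity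
  set κ : ℝ := ((n + 1 : ℕ) : ℝ) with hκ
  -- The cosine vectors are completed by the constant unit vector. Row `0` is set separately because
  -- `cosVec` at frequency `0` would have norm `√2`.
  obtain ⟨V, hV⟩ : ∃ V : Matrix (Fin (n + 1)) (Fin (n + 1)) ℝ, ∀ i j,
      V i j = if i = 0 then (Real.sqrt κ)⁻¹ else cosVec (n + 1) i (j + 1) :=
    ⟨fun i j => _, fun i j => rfl⟩
  have hss : Real.sqrt κ * Real.sqrt κ = κ := Real.mul_self_sqrt hk0.le
  have hsi : (Real.sqrt κ)⁻¹ * (Real.sqrt κ)⁻¹ = κ⁻¹ := by rw [← mul_inv, hss]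
  have hVV : V * V.transpose = 1 := by
    ext i l
    rw [Matrix.mul_apply, Matrix.one_apply]
    simp only [Matrix.transpose_apply, hV]
    have hpos : ∀ i : Fin (n + 1), i ≠ 0 → 1 ≤ (i : ℕ) := fun i hi =>
      Nat.one_le_iff_ne_zero.2 fun h => hi (Fin.ext h)
    by_cases hi : i = 0 <;> by_cases hl : l = 0
    · simp only [hi, hl, if_true, hsi, Finset.sum_const, Finset.card_univ, Fintype.card_fin, nsmul_eq_mul]
      exact mul_inv_cancel₀ hk0.ne'
    · simp only [hi, hl, if_true, if_false, ← Finset.mul_sum]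
      rw [← hIcc (fun j => cosVec (n + 1) l j), sum_cosVec_eq_zero (hpos l hl) l.2, mul_zero,
        if_neg (Ne.symm hl)]
    · simp only [hi, hl, if_true, if_false, ← Finset.sum_mul]
      rw [← hIcc (fun j => cosVec (n + 1) i j), sum_cosVec_eq_zero (hpos i hi) i.2, zero_mul]
    · simp only [hi, hl, if_false]
      rw [← hIcc (fun j => cosVec (n + 1) i j * cosVec (n + 1) l j),
        sum_cosVec_mul_cosVec (hpos i hi) i.2 (hpos l hl) l.2]
      simp [Fin.ext_iff]
  have hVV' : V.transpose * V = 1 := mul_eq_one_comm.1 hVV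
  have hpars : ∀ z : Fin (n + 1) → ℝ, ∑ i, (∑ j, V i j * z j) ^ 2 = ∑ j, z j ^ 2 := fun z => by
    have h1 : ∑ i, (∑ j, V i j * z j) ^ 2 = (V.mulVec z) ⬝ᵥ (V.mulVec z) := by
      simp [dotProduct, Matrix.mulVec, sq]
    rw [h1, Matrix.dotProduct_mulVec, ← Matrix.mulVec_transpose, Matrix.mulVec_mulVec, hVV',
      Matrix.one_mulVec]
    simp [dotProduct, sq]
  have h := hpars fun j => y (j + 1)
  rw [Fin.sum_univ_succ] at h
  simp only [hV, if_true, Fin.succ_ne_zero, if_false, ← Finset.mul_sum, Fin.val_succ] at h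
  simp only [hIcc]
  -- The coefficient along the constant vector has square `S ^ 2 / κ`, exactly what subtracting the
  -- mean removes from the sum of squares.
  rw [show ∑ i : Fin (n + 1 - 1), (∑ j : Fin (n + 1),
    cosVec (n + 1) (i + 1) (j + 1) * y (j + 1)) ^ 2 = _ from eq_sub_of_add_eq' h]
  set S := ∑ j : Fin (n + 1), y (j + 1) with hS
  have e : ∀ j : Fin (n + 1), (y (j + 1) - 1 / κ * S) ^ 2 =
      y (j + 1) ^ 2 - 2 * (1 / κ * S) * y (j + 1) + (1 / κ * S) ^ 2 := fun j => by ring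
  simp_rw [e]
  rw [Finset.sum_add_distrib, Finset.sum_sub_distrib, ← Finset.mul_sum, ← hS,
    show ((√κ)⁻¹ * S) ^ 2 = κ⁻¹ * S ^ 2 by rw [mul_pow, sq (√κ)⁻¹, hsi]]
  simp only [Finset.sum_const, Finset.card_univ, Fintype.card_fin, nsmul_eq_mul, ← hκ]
  field_simp
  ring

/-- Needed because normalizing by `s n` is an exact identity only once `s n > 0`. -/
theorem TendstoInDistribution.congr_eventually {Ω Ω' E : Type*} [MeasurableSpace Ω]
    [MeasurableSpace Ω'] [TopologicalSpace E] [MeasurableSpace E] [OpensMeasurableSpace E]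
    {P : Measure Ω} [IsProbabilityMeasure P] {P' : Measure Ω'} [IsProbabilityMeasure P']
    {X Y : ℕ → Ω → E} {Z : Ω' → E} (h : TendstoInDistribution X atTop Z (fun _ => P) P')
    (hY : ∀ n, AEMeasurable (Y n) P) (hXY : ∀ᶠ n in atTop, X n = Y n) :
    TendstoInDistribution Y atTop Z (fun _ => P) P' := by
  refine ⟨hY, h.aemeasurable_limit, h.tendsto.congr' ?_⟩
  filter_upwards [hXY] with n hn
  exact Subtype.ext (by simp [hn])

theorem limitWeight_pos {k i : ℕ} (hi : 1 ≤ i) (hik : i < k) : 0 < limitWeight k i := by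
  have hi' : (0 : ℝ) < i := by exact_mod_cast hi
  have hik' : (i : ℝ) < k := by exact_mod_cast hik
  have hk : (0 : ℝ) < k := hi'.trans hik'
  have h : (i : ℝ) / k < 1 := (div_lt_one hk).2 hik'
  have hsin : 0 < Real.sin ((i : ℝ) / k * (Real.pi / 2)) :=
    Real.sin_pos_of_pos_of_lt_pi (by positivity) (by nlinarith [Real.pi_pos])
  unfold limitWeight
  positivity

theorem abs_indicator_one_le {α : Type*} (S : Set α) (x : α) : |S.indicator (fun _ => (1 : ℝ)) x| ≤ 1 := by
  by_cases h : x ∈ S <;> simp [h]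

/-! ### Counts of nested rare events. -/

section NestedSets

variable {α : Type*} [MeasurableSpace α] {μ : Measure α}
  {k : ℕ} {B : ℕ → ℕ → Set α} {s : ℕ → ℝ}

/-- The hypothesis says that the mean of the weighted count is `s ^ 2 + o(s)`; dividing by `s ^ 2`
keeps only the leading order. -/
theorem tendsto_scaled_prob (hs : Tendsto s atTop atTop)
    {j : ℕ} (hp : Tendsto (fun n : ℕ => n * (j * μ.real (B n j)) * (s n)⁻¹ - s n) atTop (𝓝 0)) :
    Tendsto (fun n : ℕ => n * (j * μ.real (B n j)) * ((s n)⁻¹ * (s n)⁻¹)) atTop (𝓝 1) := by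
  have h := (hp.mul (tendsto_inv_atTop_zero.comp hs)).add_const 1
  simp only [mul_zero, zero_add] at h
  refine h.congr' ?_
  filter_upwards [hs.eventually_gt_atTop 0] with n hn
  simp only [Function.comp]
  field_simp
  ring

theorem integral_indicator_mul_indicator {S T : Set α} (hS : MeasurableSet S) (h : S ⊆ T) :
    ∫ x, S.indicator (fun _ => (1 : ℝ)) x * T.indicator (fun _ => 1) x ∂μ = μ.real S := by
  rw [← integral_indicator_one hS]
  congr 1 with x
  by_cases hx : x ∈ S
  · simp [hx, h hx]
  · simp [hx]

/-- Second moments of the counts of nested sets. -/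
theorem tendsto_second_moment (hB : ∀ n j, MeasurableSet (B n j))
    (hmono : ∀ᶠ n in atTop, ∀ j l, 1 ≤ j → j ≤ l → B n l ⊆ B n j)
    (hs : Tendsto s atTop atTop) (hp : ∀ j ∈ Finset.Icc 1 k,
      Tendsto (fun n : ℕ => n * (j * μ.real (B n j)) * (s n)⁻¹ - s n) atTop (𝓝 0))
    {j m : ℕ} (hj : j ∈ Finset.Icc 1 k) (hm : m ∈ Finset.Icc 1 k) :
    Tendsto (fun n : ℕ => n * (j * m * ∫ x, (B n j).indicator (fun _ => (1 : ℝ)) x *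
      (B n m).indicator (fun _ => 1) x ∂μ) * ((s n)⁻¹ * (s n)⁻¹)) atTop (𝓝 (min j m : ℕ)) := by
  wlog hjm : m ≤ j generalizing j m
  · have h := this hm hj (by omega)
    rw [min_comm] at h
    refine h.congr fun n => ?_
    rw [mul_comm (j : ℝ) m]
    simp_rw [mul_comm ((B n m).indicator (fun _ => (1 : ℝ)) _)]
  rw [min_eq_right hjm]
  -- The intersection is the smaller set `B n j`. Its probability absorbs the weight `j`, and the
  -- remaining weight `m` is the minimum.
  have h := (tendsto_scaled_prob hs (hp j hj)).const_mul (m : ℝ)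
  rw [mul_one] at h
  refine h.congr' ?_
  filter_upwards [hmono] with n hn
  rw [integral_indicator_mul_indicator (hB n j) (hn m j (Finset.mem_Icc.1 hm).1 hjm)]
  ring

variable [IsProbabilityMeasure μ] {Ω : Type*} [MeasurableSpace Ω] {P : Measure Ω} [IsProbabilityMeasure P]
  {X : ℕ → Ω → α}

/-- The normalized average of the weighted counts tends to `1`. -/
theorem tendstoInMeasure_mean_count (hk : 1 ≤ k) (hX : ∀ r, HasLaw (X r) μ P)
    (hXm : ∀ r, Measurable (X r)) (hindep : iIndepFun X P) (hB : ∀ n j, MeasurableSet (B n j))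
    (hs : Tendsto s atTop atTop) (hp : ∀ j ∈ Finset.Icc 1 k,
      Tendsto (fun n : ℕ => n * (j * μ.real (B n j)) * (s n)⁻¹ - s n) atTop (𝓝 0)) :
    TendstoInMeasure P (fun n ω => ∑ r ∈ Finset.range n, (s n)⁻¹ * (s n)⁻¹ * (1 / (k : ℝ) *
      ∑ l ∈ Finset.Icc 1 k, (l : ℝ) * (B n l).indicator (fun _ => (1 : ℝ)) (X r ω)))
      atTop (fun _ => 1) := by
  have hk0 : (k : ℝ) ≠ 0 := by positivity
  have hind : ∀ n l, Measurable ((B n l).indicator fun _ => (1 : ℝ)) := fun n l =>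
    measurable_const.indicator (hB n l)
  have hii : ∀ n l, Integrable ((B n l).indicator fun _ => (1 : ℝ)) μ := fun n l =>
    (integrable_const _).indicator (hB n l)
  set A : ℝ := 1 / (k : ℝ) * ∑ l ∈ Finset.Icc 1 k, (l : ℝ) with hA
  let g : ℕ → α → ℝ := fun n x => (s n)⁻¹ * (s n)⁻¹ * (1 / (k : ℝ) *
    ∑ l ∈ Finset.Icc 1 k, (l : ℝ) * (B n l).indicator (fun _ => (1 : ℝ)) x)
  have hgm : ∀ n, Measurable (g n) := fun n =>
    ((Finset.measurable_fun_sum _ fun l _ => (hind n l).const_mul _).const_mul _).const_mul _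
  have hg0 : ∀ n x, 0 ≤ g n x := fun n x =>
    mul_nonneg (mul_self_nonneg _) (mul_nonneg (by positivity) (Finset.sum_nonneg fun l _ =>
      mul_nonneg (by positivity) (Set.indicator_nonneg (fun _ _ => zero_le_one) _)))
  have hgA : ∀ n x, g n x ≤ (s n)⁻¹ * (s n)⁻¹ * A := fun n x =>
    mul_le_mul_of_nonneg_left (mul_le_mul_of_nonneg_left (Finset.sum_le_sum fun l _ =>
      mul_le_of_le_one_right (by positivity) ((le_abs_self _).trans (abs_indicator_one_le _ _)))
      (by positivity)) (mul_self_nonneg _)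
  have hK : ∀ n x, |g n x| ≤ (s n)⁻¹ * (s n)⁻¹ * A := fun n x => by
    rw [abs_of_nonneg (hg0 n x)]; exact hgA n x
  have h1 : Tendsto (fun n : ℕ => (n : ℝ) * ∫ x, g n x ∂μ) atTop (𝓝 1) := by
    have h := (tendsto_finsetSum (Finset.Icc 1 k) fun l hl =>
      tendsto_scaled_prob hs (hp l hl)).const_mul (1 / (k : ℝ))
    have e : 1 / (k : ℝ) * ∑ l ∈ Finset.Icc 1 k, (1 : ℝ) = 1 := by
      simp [hk0]
    rw [e] at h
    refine h.congr fun n => ?_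
    rw [integral_const_mul, integral_const_mul, integral_finsetSum _ fun l _ =>
      (hii n l).const_mul _, Finset.mul_sum, Finset.mul_sum, Finset.mul_sum, Finset.mul_sum]
    refine Finset.sum_congr rfl fun l _ => ?_
    have : ∫ x, (B n l).indicator (fun _ => (1 : ℝ)) x ∂μ = μ.real (B n l) :=
      integral_indicator_one (hB n l)
    rw [integral_const_mul, this]
    ring
  refine tendstoInMeasure_sum_rows hX hXm hindep hgm hK h1 ?_
  have hi := tendsto_inv_atTop_zero.comp hs
  -- From `0 ≤ g ≤ K` follows `g ^ 2 ≤ K g`, so the second moment is bounded by the convergent first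
  -- one times a null sequence.
  have hb : Tendsto (fun n : ℕ => (s n)⁻¹ * (s n)⁻¹ * A * (n * ∫ x, g n x ∂μ)) atTop (𝓝 0) := by
    simpa using ((hi.mul hi).mul_const A).mul h1
  refine tendsto_of_tendsto_of_tendsto_of_le_of_le tendsto_const_nhds hb
    (fun n => mul_nonneg (by positivity) (integral_nonneg fun x => sq_nonneg _)) fun n => ?_
  have hL := memLp_two_of_abs_le (μ := μ) (hgm n) (hK n)
  simp only
  rw [mul_left_comm, ← integral_const_mul ((s n)⁻¹ * (s n)⁻¹ * A)]
  refine mul_le_mul_of_nonneg_left (integral_mono hL.integrable_sq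
    ((hL.integrable (by norm_num)).const_mul _) fun x => ?_) (by positivity)
  simp only [sq]
  exact mul_le_mul_of_nonneg_right (hgA n x) (hg0 n x)

variable {Ω' : Type*} [MeasurableSpace Ω'] {P' : Measure Ω'} [IsProbabilityMeasure P']

/-- The normalized discrete cosine transform of the weighted counts of nested sets is
asymptotically standard normal. -/
theorem tendstoInDistribution_cos_transform (hX : ∀ r, HasLaw (X r) μ P)
    (hXm : ∀ r, Measurable (X r)) (hindep : iIndepFun X P) (hB : ∀ n j, MeasurableSet (B n j))
    (hmono : ∀ᶠ n in atTop, ∀ j l, 1 ≤ j → j ≤ l → B n l ⊆ B n j)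
    (hs : Tendsto s atTop atTop) (hp : ∀ j ∈ Finset.Icc 1 k,
      Tendsto (fun n : ℕ => n * (j * μ.real (B n j)) * (s n)⁻¹ - s n) atTop (𝓝 0))
    {ξ : Fin (k - 1) → Ω' → ℝ} (hξ : ∀ i, HasLaw (ξ i) (gaussianReal 0 1) P')
    (hξindep : iIndepFun ξ P') :
    TendstoInDistribution (fun (n : ℕ) (ω : Ω) (i : Fin (k - 1)) => ∑ r ∈ Finset.range n,
      (s n)⁻¹ * ∑ j ∈ Finset.Icc 1 k, (√(limitWeight k (i + 1)))⁻¹ * cosVec k (i + 1) j *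
        (j * (B n j).indicator (fun _ => (1 : ℝ)) (X r ω)))
      atTop (fun ω' i => ξ i ω') (fun _ => P) P' := by
  have hind : ∀ n l, Measurable ((B n l).indicator fun _ => (1 : ℝ)) := fun n l =>
    measurable_const.indicator (hB n l)
  have hii : ∀ n l, Integrable ((B n l).indicator fun _ => (1 : ℝ)) μ := fun n l =>
    (integrable_const _).indicator (hB n l)
  have hi2 : ∀ n j m, Integrable (fun x => (B n j).indicator (fun _ => (1 : ℝ)) x *
      (B n m).indicator (fun _ => 1) x) μ := fun n j m =>
    (memLp_two_of_abs_le (hind n j) fun x => abs_indicator_one_le _ x).integrable_mul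
      (memLp_two_of_abs_le (hind n m) fun x => abs_indicator_one_le _ x)
  -- Dividing by the root of the eigenvalue turns the limiting covariance into the identity.
  let a : Fin (k - 1) → ℕ → ℝ := fun i j => (√(limitWeight k (i + 1)))⁻¹ * cosVec k (i + 1) j
  have hpos : ∀ i : Fin (k - 1), 0 < limitWeight k (i + 1) := fun i =>
    limitWeight_pos (by omega) (by omega)
  have ha : ∀ i, ∑ j ∈ Finset.Icc 1 k, a i j = 0 := fun i => by
    simp only [a]
    rw [← Finset.mul_sum, sum_cosVec_eq_zero (by omega) (by omega), mul_zero]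
  have haa : ∀ i l, ∑ j ∈ Finset.Icc 1 k, ∑ m ∈ Finset.Icc 1 k, a i j * a l m * (min j m : ℕ) =
      if i = l then 1 else 0 := fun i l => by
    have h := sum_sum_min_mul_cosVec (k := k) (i := i + 1) (l := l + 1) (by omega) (by omega)
      (by omega) (by omega)
    have e : ∑ j ∈ Finset.Icc 1 k, ∑ m ∈ Finset.Icc 1 k, a i j * a l m * ((min j m : ℕ) : ℝ) =
        (√(limitWeight k (i + 1)))⁻¹ * (√(limitWeight k (l + 1)))⁻¹ *
        ∑ j ∈ Finset.Icc 1 k, ∑ m ∈ Finset.Icc 1 k,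
          cosVec k (i + 1) j * cosVec k (l + 1) m * (min j m : ℕ) := by
      simp only [Finset.mul_sum, a]
      exact Finset.sum_congr rfl fun j _ => Finset.sum_congr rfl fun m _ => by ring
    rw [e, h]
    by_cases hil : i = l
    · subst hil
      simp only [if_true]
      rw [← mul_inv, Real.mul_self_sqrt (hpos i).le, inv_mul_cancel₀ (hpos i).ne']
    · have : (i : ℕ) + 1 ≠ l + 1 := fun h => hil (Fin.ext (by omega))
      rw [if_neg this, if_neg hil, mul_zero]
  have hi := tendsto_inv_atTop_zero.comp hs
  refine tendstoInDistribution_sum_rows hX hXm hindep hξ hξindep (g := fun n i x =>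
    (s n)⁻¹ * ∑ j ∈ Finset.Icc 1 k, a i j * (j * (B n j).indicator (fun _ => (1 : ℝ)) x))
    (K := fun n => |(s n)⁻¹| * ∑ i, ∑ j ∈ Finset.Icc 1 k, |a i j| * j) ?_ ?_ ?_ ?_ ?_
  · exact fun n i => (Finset.measurable_fun_sum _ fun j _ =>
      ((hind n j).const_mul _).const_mul _).const_mul _
  · intro n i x
    rw [abs_mul]
    refine mul_le_mul_of_nonneg_left ?_ (abs_nonneg _)
    refine ((Finset.abs_sum_le_sum_abs _ _).trans (Finset.sum_le_sum fun j _ => ?_)).trans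
      (Finset.single_le_sum (f := fun i => ∑ j ∈ Finset.Icc 1 k, |a i j| * (j : ℝ))
        (fun i _ => Finset.sum_nonneg fun j _ => by positivity) (Finset.mem_univ i))
    rw [abs_mul (a i j), abs_mul (j : ℝ), Nat.abs_cast]
    exact mul_le_mul_of_nonneg_left (mul_le_of_le_one_right (by positivity)
      (abs_indicator_one_le _ _)) (abs_nonneg _)
  · simpa using hi.abs.mul_const _
  · intro i
    have h := tendsto_finsetSum (Finset.Icc 1 k) fun j hj => (hp j hj).const_mul (a i j)
    simp only [mul_zero, Finset.sum_const_zero] at h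
    refine h.congr fun n => ?_
    -- The coefficients sum to zero, so the diverging common mean cancels and no explicit centring
    -- of the counts is needed.
    have e : ∑ j ∈ Finset.Icc 1 k, a i j * s n = 0 := by rw [← Finset.sum_mul, ha, zero_mul]
    simp_rw [mul_sub]
    rw [Finset.sum_sub_distrib, e, sub_zero, integral_const_mul,
      integral_finsetSum _ fun j _ => ((hii n j).const_mul _).const_mul _, Finset.mul_sum,
      Finset.mul_sum]
    refine Finset.sum_congr rfl fun j _ => ?_
    have : ∫ x, (B n j).indicator (fun _ => (1 : ℝ)) x ∂μ = μ.real (B n j) :=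
      integral_indicator_one (hB n j)
    rw [integral_const_mul, integral_const_mul, this]
    ring
  · intro i l
    have h := tendsto_finsetSum (Finset.Icc 1 k) fun j hj =>
      tendsto_finsetSum (Finset.Icc 1 k) fun m hm =>
        (tendsto_second_moment hB hmono hs hp hj hm).const_mul (a i j * a l m)
    rw [haa] at h
    refine h.congr fun n => ?_
    have e : ∀ x, ((s n)⁻¹ * ∑ j ∈ Finset.Icc 1 k, a i j *
          (j * (B n j).indicator (fun _ => (1 : ℝ)) x)) *
        ((s n)⁻¹ * ∑ m ∈ Finset.Icc 1 k, a l m * (m * (B n m).indicator (fun _ => (1 : ℝ)) x)) =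
        ∑ j ∈ Finset.Icc 1 k, ∑ m ∈ Finset.Icc 1 k, (s n)⁻¹ * (s n)⁻¹ * (a i j * a l m) * (j * m) *
          ((B n j).indicator (fun _ => (1 : ℝ)) x * (B n m).indicator (fun _ => 1) x) :=
      fun x => by
        rw [mul_mul_mul_comm, Finset.sum_mul_sum, Finset.mul_sum]
        refine Finset.sum_congr rfl fun j _ => ?_
        rw [Finset.mul_sum]
        exact Finset.sum_congr rfl fun m _ => by ring
    simp_rw [e]
    rw [integral_finsetSum _ fun j _ => integrable_finsetSum _ fun m _ =>
      (hi2 n j m).const_mul _, Finset.mul_sum]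
    refine Finset.sum_congr rfl fun j _ => ?_
    rw [integral_finsetSum _ fun m _ => (hi2 n j m).const_mul _, Finset.mul_sum]
    refine Finset.sum_congr rfl fun m _ => ?_
    rw [integral_const_mul]
    ring

/-- The studentized sum of squares of the weighted counts of nested sets converges in
distribution to a weighted sum of squares of independent standard normal variables. -/
theorem tendstoInDistribution_studentized_counts (hk : 1 ≤ k) (hX : ∀ r, HasLaw (X r) μ P)
    (hXm : ∀ r, Measurable (X r)) (hindep : iIndepFun X P) (hB : ∀ n j, MeasurableSet (B n j))
    (hmono : ∀ᶠ n in atTop, ∀ j l, 1 ≤ j → j ≤ l → B n l ⊆ B n j)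
    (hs : Tendsto s atTop atTop) (hp : ∀ j ∈ Finset.Icc 1 k,
      Tendsto (fun n : ℕ => n * (j * μ.real (B n j)) * (s n)⁻¹ - s n) atTop (𝓝 0))
    {ξ : Fin (k - 1) → Ω' → ℝ} (hξ : ∀ i, HasLaw (ξ i) (gaussianReal 0 1) P')
    (hξindep : iIndepFun ξ P') {N : ℕ → ℕ → Ω → ℝ}
    (hN : ∀ n j ω, N n j ω =
      ∑ r ∈ Finset.range n, (B n j).indicator (fun _ => (1 : ℝ)) (X r ω)) :
    TendstoInDistribution (fun n ω =>
      (∑ j ∈ Finset.Icc 1 k,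
        (j * N n j ω - 1 / (k : ℝ) * ∑ l ∈ Finset.Icc 1 k, l * N n l ω) ^ 2) /
        (1 / (k : ℝ) * ∑ l ∈ Finset.Icc 1 k, l * N n l ω)) atTop
      (fun ω' => ∑ i : Fin (k - 1), limitWeight k ((i : ℕ) + 1) * ξ i ω' ^ 2)
      (fun _ => P) P' := by
  have hind : ∀ n l, Measurable ((B n l).indicator fun _ => (1 : ℝ)) := fun n l =>
    measurable_const.indicator (hB n l)
  have hNm : ∀ n j, Measurable (N n j) := fun n j => by
    have : N n j = fun ω => ∑ r ∈ Finset.range n, (B n j).indicator (fun _ => (1 : ℝ)) (X r ω) :=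
      funext (hN n j)
    rw [this]
    exact Finset.measurable_fun_sum _ fun r _ => (hind n j).comp (hXm r)
  have hMm : ∀ n, Measurable fun ω => 1 / (k : ℝ) * ∑ l ∈ Finset.Icc 1 k, l * N n l ω := fun n =>
    (Finset.measurable_fun_sum _ fun l _ => (hNm n l).const_mul _).const_mul _
  have hη := tendstoInDistribution_cos_transform hX hXm hindep hB hmono hs hp hξ hξindep
  have hD := TendstoInMeasure.comp_continuousAt
    (tendstoInMeasure_mean_count hk hX hXm hindep hB hs hp) (f := fun x => x⁻¹)
    (continuousAt_inv₀ one_ne_zero)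
  have hDm : ∀ n, Measurable fun ω => (∑ r ∈ Finset.range n, (s n)⁻¹ * (s n)⁻¹ * (1 / (k : ℝ) *
      ∑ l ∈ Finset.Icc 1 k, (l : ℝ) * (B n l).indicator (fun _ => (1 : ℝ)) (X r ω)))⁻¹ :=
    fun n => (Finset.measurable_fun_sum _ fun r _ => ((Finset.measurable_fun_sum _ fun l _ =>
      ((hind n l).comp (hXm r)).const_mul _).const_mul _).const_mul _).inv
  -- Slutsky's theorem needs a globally continuous map. Inversion, continuous only away from zero,
  -- was therefore applied beforehand to the denominator, whose limit is `1`.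
  have hcomp := hη.continuous_comp_prodMk_of_tendstoInMeasure_const
    (g := fun p : (Fin (k - 1) → ℝ) × ℝ =>
      (∑ i : Fin (k - 1), limitWeight k ((i : ℕ) + 1) * p.1 i ^ 2) * p.2)
    (by fun_prop) hD fun n => (hDm n).aemeasurable
  simp only [inv_one, mul_one] at hcomp
  refine TendstoInDistribution.congr_eventually hcomp (fun n => Measurable.aemeasurable ?_) ?_
  · exact (Finset.measurable_fun_sum _ fun j _ =>
      (((hNm n j).const_mul _).sub (hMm n)).pow_const 2).div (hMm n)
  -- For `s n > 0` the powers of `s n` cancel at every `ω`; where the denominator vanishes, both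
  -- sides are `0` by the convention for division by zero.
  · filter_upwards [hs.eventually_gt_atTop 0] with n hn
    ext ω
    have e1 : ∑ r ∈ Finset.range n, (s n)⁻¹ * (s n)⁻¹ * (1 / (k : ℝ) *
        ∑ l ∈ Finset.Icc 1 k, (l : ℝ) * (B n l).indicator (fun _ => (1 : ℝ)) (X r ω)) =
        (s n)⁻¹ * (s n)⁻¹ * (1 / (k : ℝ) * ∑ l ∈ Finset.Icc 1 k, l * N n l ω) := by
      rw [← Finset.mul_sum, ← Finset.mul_sum, Finset.sum_comm]
      simp only [← Finset.mul_sum, ← hN]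
    have e2 : ∀ i : Fin (k - 1), ∑ r ∈ Finset.range n,
        (s n)⁻¹ * ∑ j ∈ Finset.Icc 1 k, (√(limitWeight k (i + 1)))⁻¹ * cosVec k (i + 1) j *
        (j * (B n j).indicator (fun _ => (1 : ℝ)) (X r ω)) =
        (s n)⁻¹ * (√(limitWeight k (i + 1)))⁻¹ *
          ∑ j ∈ Finset.Icc 1 k, cosVec k (i + 1) j * (j * N n j ω) := fun i => by
      rw [← Finset.mul_sum, Finset.sum_comm, mul_assoc, Finset.mul_sum (a := (√_)⁻¹)]
      simp only [← Finset.mul_sum, ← hN, mul_assoc]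
    have e3 : ∀ i : Fin (k - 1), limitWeight k (i + 1) * ((s n)⁻¹ * (√(limitWeight k (i + 1)))⁻¹ *
          ∑ j ∈ Finset.Icc 1 k, cosVec k (i + 1) j * (j * N n j ω)) ^ 2 =
        (s n)⁻¹ * (s n)⁻¹ * (∑ j ∈ Finset.Icc 1 k, cosVec k (i + 1) j * (j * N n j ω)) ^ 2 :=
      fun i => by
        have hw : 0 < limitWeight k (i + 1) := limitWeight_pos (by omega) (by omega)
        rw [mul_pow, mul_pow, inv_pow (√_), Real.sq_sqrt hw.le]
        field_simp
    simp only [e1, e2, e3]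
    rw [← Finset.mul_sum, ← sum_sub_mean_sq hk fun j => j * N n j ω, mul_inv,
      mul_mul_mul_comm, mul_inv_cancel₀ (by positivity), one_mul]
    exact (div_eq_mul_inv _ _).symm

end NestedSets

/-! ### From the copula to nested events. -/

/-- A sum of nonnegative indicators is positive when one of them is. Hence the exceedance
probabilities involve `C` only on the diagonal. -/
theorem setOf_sojourn_pos {d : ℕ} (s : ℝ) :
    {u : Fin d → ℝ | 0 < sojourn u s} = (Set.Iic fun _ => 1 + s)ᶜ := by
  ext u
  have h0 : ∀ i ∈ Finset.univ, 0 ≤ (Set.Ioi s).indicator (fun _ => (1 : ℝ)) (u i - 1) :=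
    fun i _ => Set.indicator_nonneg (fun _ _ => zero_le_one) _
  simp only [sojourn, Set.mem_ofPred_eq, Set.mem_compl_iff, Set.mem_Iic, Pi.le_def, not_forall,
    not_le]
  rw [Finset.sum_pos_iff_of_nonneg h0]
  refine exists_congr fun i => ?_
  by_cases h : s < u i - 1
  · have : 1 + s < u i := by linarith
    simp [h, this]
  · have : ¬ 1 + s < u i := fun h' => h (by linarith)
    simp [h, this]

/-- Random vectors with a common distribution function have a common law. -/
theorem hasLaw_of_forall_measureReal_le {d : ℕ} {C : (Fin d → ℝ) → ℝ}
    {Ω : Type*} [MeasurableSpace Ω] {P : Measure Ω} [IsProbabilityMeasure P]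
    {U : ℕ → Ω → Fin d → ℝ} (hU : ∀ i, Measurable (U i))
    (hdf : ∀ i u, P.real {ω | U i ω ≤ u} = C u) (r : ℕ) : HasLaw (U r) (P.map (U 0)) P := by
  have (i : ℕ) : IsProbabilityMeasure (P.map (U i)) :=
    Measure.isProbabilityMeasure_map (hU i).aemeasurable
  refine ⟨(hU r).aemeasurable, measure_eq_of_forall_Iic_eq fun u => ?_⟩
  rw [Measure.map_apply (hU r) measurableSet_Iic, Measure.map_apply (hU 0) measurableSet_Iic]
  exact (measureReal_eq_measureReal_iff (by finiteness) (by finiteness)).1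
    ((hdf r u).trans (hdf 0 u).symm)

/-- The rate of a copula in a `δ`-neighborhood of a generalized Pareto copula along the diagonal. -/
theorem InDeltaNeighborhood.exists_diagonal_bound {d : ℕ} (hd : 1 ≤ d) {C : (Fin d → ℝ) → ℝ}
    {δ : ℝ} (h : InDeltaNeighborhood δ C) :
    ∃ m : ℝ, 0 < m ∧ ∃ A : ℝ, ∀ᶠ t in 𝓝[>] (0 : ℝ),
      |1 - C (fun _ => 1 + -t) - t * m| ≤ A * (t * m) ^ (1 + δ) := by
  obtain ⟨N, ⟨hN, -⟩, hO⟩ := h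
  -- Dimension at least one is essential: in dimension zero the vector of ones is zero.
  have hm : 0 < N 1 := by
    refine (apply_nonneg N 1).lt_of_ne fun h => ?_
    exact one_ne_zero (congrFun (hN 1 h.symm) ⟨0, hd⟩)
  obtain ⟨A, hA⟩ := hO.bound
  refine ⟨N 1, hm, A, ?_⟩
  have hu : Tendsto (fun t : ℝ => (fun _ : Fin d => 1 + -t)) (𝓝[>] 0) (𝓝[Set.Icc 0 1] 1) := by
    refine tendsto_nhdsWithin_iff.2 ⟨?_, ?_⟩
    · have : Continuous fun t : ℝ => (fun _ : Fin d => 1 + -t) := by fun_prop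
      have h := this.tendsto 0
      simp only [neg_zero, add_zero] at h
      exact h.mono_left nhdsWithin_le_nhds
    · filter_upwards [Ioo_mem_nhdsGT (zero_lt_one' ℝ)] with t ht
      exact ⟨fun _ => by simpa using ht.2.le, fun _ => by simpa using ht.1.le⟩
  filter_upwards [hu.eventually hA, self_mem_nhdsWithin] with t ht ht0
  have ht0' : 0 < t := ht0
  have e : N ((fun _ : Fin d => 1 + -t) - 1) = t * N 1 := by
    have : ((fun _ : Fin d => 1 + -t) - 1) = (-t) • (1 : Fin d → ℝ) := by
      ext i; simp
    rw [this, map_smul_eq_mul, norm_neg, Real.norm_of_nonneg ht0'.le]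
  rw [e, Real.norm_eq_abs, Real.norm_of_nonneg (by positivity)] at ht
  rw [abs_sub_comm] at ht
  convert ht using 2
  ring

theorem mainTheorem1
    {d : ℕ} (hd : 1 ≤ d) {C : (Fin d → ℝ) → ℝ} (hC : IsCopula C)
    {δ : ℝ} (hδ : 0 < δ) (hCδ : InDeltaNeighborhood δ C)
    {k : ℕ} (hk : 1 ≤ k)
    {Ω : Type*} [MeasurableSpace Ω] (P : Measure Ω) [IsProbabilityMeasure P]
    (U : ℕ → Ω → Fin d → ℝ) (hU : ∀ i, Measurable (U i)) (hindep : iIndepFun U P)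
    (hdf : ∀ i u, P.real {ω | U i ω ≤ u} = C u)
    (c : ℕ → ℝ) (hc : Tendsto c atTop (𝓝 0))
    (hnc : Tendsto (fun n : ℕ => (n : ℝ) * c n) atTop atTop)
    (hncδ : Tendsto (fun n : ℕ => (n : ℝ) * c n ^ (1 + 2 * δ)) atTop (𝓝 0))
    {Ω' : Type*} [MeasurableSpace Ω'] (P' : Measure Ω') [IsProbabilityMeasure P']
    (ξ : Fin (k - 1) → Ω' → ℝ) (hξ : ∀ i, HasLaw (ξ i) (gaussianReal 0 1) P')
    (hξindep : iIndepFun ξ P') :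
    TendstoInDistribution
      (fun (n : ℕ) (ω : Ω) => testStatistic (fun i => U i ω) k n (c n)) atTop
      (fun ω' : Ω' => ∑ i : Fin (k - 1), limitWeight k ((i : ℕ) + 1) * ξ i ω' ^ 2)
      (fun _ => P) P' := by
  have : IsProbabilityMeasure (P.map (U 0)) :=
    Measure.isProbabilityMeasure_map (hU 0).aemeasurable
  obtain ⟨m, hm, A, hA⟩ := hCδ.exists_diagonal_bound hd
  -- Eventual positivity of `c n` is already forced by `n c n → ∞`.
  have hcpos : ∀ᶠ n in atTop, 0 < c n := by
    filter_upwards [hnc.eventually_gt_atTop 0] with n hn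
    exact pos_of_mul_pos_right hn (Nat.cast_nonneg n)
  have hBeq (n j : ℕ) : {u : Fin d → ℝ | 0 < sojourn u (-(c n / j))} =
      (Set.Iic fun _ => 1 + -(c n / j))ᶜ := setOf_sojourn_pos _
  have hs : Tendsto (fun n : ℕ => √((n : ℝ) * c n * m)) atTop atTop :=
    Real.tendsto_sqrt_atTop.comp (hnc.atTop_mul_const hm)
  refine tendstoInDistribution_studentized_counts (μ := P.map (U 0)) hk
    (B := fun n j => {u : Fin d → ℝ | 0 < sojourn u (-(c n / j))})
    (s := fun n => √((n : ℝ) * c n * m))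
    (N := fun n j ω => exceedanceCount (fun i => U i ω) n j (c n))
    (hasLaw_of_forall_measureReal_le hU hdf) hU hindep ?_ ?_ hs ?_ hξ hξindep ?_
  · intro n j
    rw [hBeq]
    exact measurableSet_Iic.compl
  · filter_upwards [hcpos] with n hn j l hj hjl
    rw [hBeq, hBeq, Set.compl_subset_compl, Set.Iic_subset_Iic]
    intro _
    have hj' : (0 : ℝ) < j := by exact_mod_cast hj
    have := div_le_div_of_nonneg_left hn.le hj' (Nat.cast_le.2 hjl)
    simp only
    linarith
  · intro j hj
    have hj' : (0 : ℝ) < j := by exact_mod_cast (Finset.mem_Icc.1 hj).1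
    have hprob : ∀ n, (P.map (U 0)).real {u : Fin d → ℝ | 0 < sojourn u (-(c n / j))} =
        1 - C fun _ => 1 + -(c n / j) := fun n => by
      rw [hBeq, probReal_compl_eq_one_sub measurableSet_Iic,
        map_measureReal_apply (hU 0) measurableSet_Iic, ← hdf 0]
      rfl
    have hcj : Tendsto (fun n => c n / j) atTop (𝓝[>] 0) := by
      refine tendsto_nhdsWithin_iff.2 ⟨by simpa using hc.div_const (j : ℝ), ?_⟩
      filter_upwards [hcpos] with n hn
      exact div_pos hn hj'
    -- The bias `n c ^ (1 + δ)` divided by the scale `√(n c)` is `√(n c ^ (1 + 2δ))`; this is where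
    -- the upper rate condition on `c` enters.
    have hb : Tendsto (fun n : ℕ => j * A * (m / j) ^ (1 + δ) * (√m)⁻¹ *
        √((n : ℝ) * c n ^ (1 + 2 * δ))) atTop (𝓝 0) := by
      have h := ((Real.continuous_sqrt.tendsto 0).comp hncδ).const_mul
        (j * A * (m / j) ^ (1 + δ) * (√m)⁻¹)
      simpa using h
    refine squeeze_zero_norm' ?_ hb
    filter_upwards [hcj.eventually hA, hcpos, hnc.eventually_gt_atTop 0] with n hn hcn hnn
    have hn0 : (0 : ℝ) < n := pos_of_mul_pos_left hnn hcn.le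
    have hs0 : 0 < √((n : ℝ) * c n * m) := Real.sqrt_pos.2 (by positivity)
    have hss : √((n : ℝ) * c n * m) * √((n : ℝ) * c n * m) = n * c n * m :=
      Real.mul_self_sqrt (by positivity)
    rw [hprob]
    have e1 : (n : ℝ) * (j * (1 - C fun _ => 1 + -(c n / j))) * (√((n : ℝ) * c n * m))⁻¹ -
        √((n : ℝ) * c n * m) = n * j * (√((n : ℝ) * c n * m))⁻¹ *
          (1 - (C fun _ => 1 + -(c n / j)) - c n / j * m) := by
      field_simp
      rw [sq, hss]
      ring
    have e2 : n * j * (√((n : ℝ) * c n * m))⁻¹ * (A * (c n / j * m) ^ (1 + δ)) =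
        j * A * (m / j) ^ (1 + δ) * (√m)⁻¹ * √((n : ℝ) * c n ^ (1 + 2 * δ)) := by
      have h1 : (c n / j * m) ^ (1 + δ) = c n ^ (1 + δ) * (m / j) ^ (1 + δ) := by
        rw [← Real.mul_rpow hcn.le (by positivity)]
        congr 1
        ring
      have h2 : √((n : ℝ) * c n * m) = √((n : ℝ) * c n) * √m := Real.sqrt_mul hnn.le m
      have h3 : (n : ℝ) * c n ^ (1 + δ) = √((n : ℝ) * c n) * √((n : ℝ) * c n ^ (1 + 2 * δ)) := by
        rw [← Real.sqrt_mul hnn.le, eq_comm, Real.sqrt_eq_iff_mul_self_eq (by positivity)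
          (by positivity)]
        have h4 : c n ^ (1 + δ) * c n ^ (1 + δ) = c n * c n ^ (1 + 2 * δ) := by
          rw [← Real.rpow_add hcn]
          nth_rewrite 2 [← Real.rpow_one (c n)]
          rw [← Real.rpow_add hcn]
          congr 1
          ring
        linear_combination -(n : ℝ) * n * h4
      have h5 : √((n : ℝ) * c n) ≠ 0 := (Real.sqrt_pos.2 hnn).ne'
      rw [h1, h2, mul_inv]
      calc _ = (j * A * (m / j) ^ (1 + δ) * (√m)⁻¹) * (√((n : ℝ) * c n))⁻¹ *
            ((n : ℝ) * c n ^ (1 + δ)) := by ring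
        _ = _ := by rw [h3, mul_assoc, inv_mul_cancel_left₀ h5]
    rw [e1, Real.norm_eq_abs, abs_mul, abs_of_nonneg (by positivity), ← e2]
    exact mul_le_mul_of_nonneg_left hn (by positivity)
  · intro n j ω
    rfl
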